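/- Let $L$ be an orthomodular lattice, with orthocomplementation $p \mapsto p^\perp$, and write $p \mathbin{\&} q = q \wedge (p \vee q^\perp)$ for the Sasaki projection. A (finite) observable of $L$ is a finite set $\mathcal O \subseteq L$ of nonzero, mutually orthogonal elements (that is, $p \le q^\perp$ for distinct $p, q \in \mathcal O$) whose join is $\top$. Let $\mathfrak G = (A, M)$ be a set $A$ with a relation $M \subseteq A \times L \times A$. For $a \in A$ and $p \in L$, say that $a$ verifies $p$, written $a \Vdash p$, if there is no $b \in A$ with $M(a, p^\perp, b)$. Call $\mathfrak G$ a model of $\mathcal T_L$ if 1. $s \Vdash \top$ for all $s \in A$; 2. $s \Vdash \bot$ for no $s \in A$; 3. for every $p \in L$ with $p \neq \top$ there is $s \in A$ that does not verify $p$; 4. for all $p \le q$ in $L$ and all $s \in A$, $s \Vdash p$ implies $s \Vdash q$; 5. for all $p, q \in L$ and all $s \in A$, $s \Vdash p$ and $s \Vdash q$ imply $s \Vdash p \mathbin{\&} q$; 6. for all $p, q \in L$ and all $s, t \in A$, $s \Vdash p$ and $M(s, q, t)$ imply $t \Vdash p \mathbin{\&} q$. Let $\mathcal H$ be a real or complex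 Hilbert space, of finite or infinite dimension, with $\dim \mathcal H \ge 3$, and let $L(\mathcal H)$ be the orthomodular lattice of its closed subspaces. Then there is no model $\mathfrak G = (A, M)$ of $\mathcal T_{L(\mathcal H)}$ with an element $a \in A$ such that every finite observable $\mathcal O$ of $L(\mathcal H)$ contains some $p \in \mathcal O$ with $a \Vdash p$. -/

import Mathlib

universe u v w

/-- An orthomodular lattice: a bounded lattice with an orthocomplementation `p ↦ pᶜ` (written
`p^⊥` in the text) that satisfies the orthomodular law. -/
class OrthomodularLattice (L : Type*) extends Lattice L, BoundedOrder L, Compl L where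
  inf_compl_eq_bot : ∀ p : L, p ⊓ pᶜ = ⊥
  sup_compl_eq_top : ∀ p : L, p ⊔ pᶜ = ⊤
  compl_compl_eq : ∀ p : L, pᶜᶜ = p
  compl_antitone : ∀ p q : L, p ≤ q → qᶜ ≤ pᶜ
  orthomodular : ∀ p q : L, p ≤ q → q = p ⊔ (q ⊓ pᶜ)

section HilbertLattice

variable {𝕜 H : Type*} [RCLike 𝕜] [NormedAddCommGroup H] [InnerProductSpace 𝕜 H]
  [CompleteSpace H]

theorem closedSubmodule_orthogonal_orthogonal (p : ClosedSubmodule 𝕜 H) :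
    p.orthogonal.orthogonal = p := by
  apply ClosedSubmodule.toSubmodule_injective
  change p.toSubmoduleᗮᗮ = p.toSubmodule
  rw [Submodule.orthogonal_orthogonal_eq_closure]
  exact IsClosed.submodule_topologicalClosure_eq p.isClosed

theorem closedSubmodule_sup_orthogonal (p : ClosedSubmodule 𝕜 H) :
    p ⊔ p.orthogonal = ⊤ := by
  rw [← closedSubmodule_orthogonal_orthogonal (p ⊔ p.orthogonal),
    ← ClosedSubmodule.inf_orthogonal, ClosedSubmodule.inf_orthogonal_eq_bot,
    ClosedSubmodule.bot_orthogonal_eq_top]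

theorem closedSubmodule_orthomodular (p q : ClosedSubmodule 𝕜 H) (hpq : p ≤ q) :
    q = p ⊔ (q ⊓ p.orthogonal) := by
  apply le_antisymm
  · intro x hx
    have : CompleteSpace p.toSubmodule := p.isClosed.completeSpace_coe
    have h1 : p.toSubmodule.starProjection x ∈ p.toSubmodule :=
      Submodule.starProjection_apply_mem _ _
    have h2 : x - p.toSubmodule.starProjection x ∈ p.toSubmoduleᗮ :=
      Submodule.sub_starProjection_mem_orthogonal x
    have h3 : x - p.toSubmodule.starProjection x ∈ q ⊓ p.orthogonal :=
      ⟨q.toSubmodule.sub_mem hx (hpq h1), h2⟩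
    have h4 : p.toSubmodule.starProjection x + (x - p.toSubmodule.starProjection x) ∈
        (p ⊔ (q ⊓ p.orthogonal)).toSubmodule :=
      Submodule.add_mem _ ((le_sup_left : p ≤ p ⊔ (q ⊓ p.orthogonal)) h1)
        ((le_sup_right : q ⊓ p.orthogonal ≤ p ⊔ (q ⊓ p.orthogonal)) h3)
    rwa [add_sub_cancel] at h4
  · exact sup_le hpq inf_le_left

/-- The Hilbert lattice `L(H)`: the closed subspaces of a Hilbert space, ordered by inclusion
(meet is intersection, join is the closure of the sum), with the orthogonal complement as
orthocomplement. -/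
noncomputable instance closedSubmoduleOrthomodularLattice :
    OrthomodularLattice (ClosedSubmodule 𝕜 H) where
  compl p := p.orthogonal
  inf_compl_eq_bot p := p.inf_orthogonal_eq_bot
  sup_compl_eq_top p := closedSubmodule_sup_orthogonal p
  compl_compl_eq p := closedSubmodule_orthogonal_orthogonal p
  compl_antitone _ _ h := ClosedSubmodule.orthogonal_le h
  orthomodular p q h := closedSubmodule_orthomodular p q h

end HilbertLattice

/-- A finite observable of `L`: a finite set of nonzero, mutually orthogonal elements whose join
is the top element. -/
structure IsObservable {L : Type*} [OrthomodularLattice L] (O : Finset L) : Prop where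
  ne_bot : ∀ p ∈ O, p ≠ ⊥
  orthogonal : ∀ p ∈ O, ∀ q ∈ O, p ≠ q → p ≤ qᶜ
  sup_eq_top : O.sup id = ⊤

/-- The Sasaki projection `p & q = q ∧ (p ∨ q^⊥)`. -/
def sasaki {L : Type*} [OrthomodularLattice L] (p q : L) : L := q ⊓ (p ⊔ qᶜ)

/-- A directed graph with arrows labelled by elements of `L`: a set `A` with a relation
`M ⊆ A × L × A`, where `M a p b` reads: measuring `a` may yield the outcome `p` and leave `b`. -/
structure MeasurementGraph (L : Type u) where
  A : Type v
  M : A → L → A → Prop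

namespace MeasurementGraph

variable {L : Type*} [OrthomodularLattice L]

/-- `a` verifies `p`: the outcome `p^⊥` cannot be obtained when measuring `a`. -/
def Verifies (G : MeasurementGraph L) (a : G.A) (p : L) : Prop := ¬ ∃ b : G.A, G.M a pᶜ b

/-- `G` is a model of the theory `T_L`: it satisfies each of the axioms of `T_L`. -/
structure IsModel (G : MeasurementGraph L) : Prop where
  verifies_top : ∀ s : G.A, G.Verifies s ⊤
  not_verifies_bot : ∀ s : G.A, ¬ G.Verifies s ⊥
  exists_not_verifies : ∀ p : L, p ≠ ⊤ → ∃ s : G.A, ¬ G.Verifies s p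
  verifies_mono : ∀ p q : L, p ≤ q → ∀ s : G.A, G.Verifies s p → G.Verifies s q
  verifies_sasaki : ∀ p q : L, ∀ s : G.A,
    G.Verifies s p → G.Verifies s q → G.Verifies s (sasaki p q)
  preservation : ∀ p q : L, ∀ s t : G.A,
    G.Verifies s p → G.M s q t → G.Verifies t (sasaki p q)

end MeasurementGraph

/-! ### Plane rotations in a three-dimensional real coordinate space. -/

section Rays

/-! The propositions verified at `a` form an up-set, closed under `sasaki`, with no orthogonal pair;
two-element observables put `p` or `pᶜ` in it. A Hilbert basis cut into `n ≥ 3` equal families gives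
an observable, so one family's span is verified. Combining three families with real coefficients
embeds the geometry of `ℝ³`, that family becoming `e₁`. There `not_mem_of_projection_rules` rotates
membership from `e₁` to the orthogonal `e₂`, a contradiction. -/

/-- A set of vectors of `ℝ³` closed under the projection rules of the Sasaki operation and without
orthogonal pairs does not contain `e₁`: membership propagates along rotations by `π / 10`. -/
theorem not_mem_of_projection_rules (C : Set (Fin 3 → ℝ))
    (h_orth : ∀ x ∈ C, ∀ y ∈ C, x ⬝ᵥ y ≠ 0)
    (h_proj : ∀ p ∈ C, ∀ r ∈ C, ∀ k n : Fin 3 → ℝ,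
      r ⬝ᵥ k = 0 → n ⬝ᵥ k = 0 → p = k + n → n ∈ C)
    (h_split : ∀ p ∈ C, ∀ (q n : Fin 3 → ℝ) (α β : ℝ),
      n ⬝ᵥ q = 0 → p = α • q + β • n → q ∈ C ∨ n ∈ C) :
    ![1, 0, 0] ∉ C := by
  -- With `r = (c, s, 0)` and `r' = (-s, c, 0)`, members `r` and `r + T r'` force `r + x r' ± y e₃`
  -- into `C`. These two are orthogonal when `y² = 1 + x²`.
  have far (c s T : ℝ) (hcs : c ^ 2 + s ^ 2 = 1) (hT : 8 ≤ T ^ 2) (hr : ![c, s, 0] ∈ C)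
      (hp : ![c - T * s, s + T * c, 0] ∈ C) : False := by
    obtain ⟨d, hd⟩ : ∃ d : ℝ, d ^ 2 = T ^ 2 - 8 := ⟨√(T ^ 2 - 8), Real.sq_sqrt (by linarith)⟩
    -- The equation says `x (T - x) = 1 + x²`, the orthogonality `h_proj` needs; its discriminant is
    -- `T² - 8`.
    obtain ⟨x, hx⟩ : ∃ x : ℝ, 2 * x ^ 2 + 1 = T * x := ⟨(T + d) / 4, by linear_combination hd / 8⟩
    obtain ⟨y, hy⟩ : ∃ y : ℝ, y ^ 2 = 1 + x ^ 2 := ⟨√(1 + x ^ 2), Real.sq_sqrt (by positivity)⟩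
    have key (z : ℝ) (hz : z ^ 2 = 1 + x ^ 2) : ![c - x * s, s + x * c, z] ∈ C := by
      refine h_proj _ hp _ hr ![-(T - x) * s, (T - x) * c, -z] _ ?_ ?_ ?_
      · simp only [Matrix.vec3_dotProduct']; ring
      · simp only [Matrix.vec3_dotProduct']
        linear_combination (T - x) * x * hcs - hz - hx
      · ext i; fin_cases i <;> simp <;> ring
    refine h_orth _ (key y hy) _ (key (-y) (by rw [neg_sq, hy])) ?_
    simp only [Matrix.vec3_dotProduct']
    linear_combination (1 + x ^ 2) * hcs - hy
  have near (c s c' s' : ℝ) (hcs : c ^ 2 + s ^ 2 = 1) (hcs' : c' ^ 2 + s' ^ 2 = 1)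
      (hs : s' ≠ 0) (hT : 8 * s' ^ 2 ≤ c' ^ 2) (hr : ![c, s, 0] ∈ C) :
      ![c * c' - s * s', s * c' + c * s', 0] ∈ C := by
    -- Split `r` along the rotated vector and its normal in the plane, scaled to `r - (c' / s') r'`;
    -- `far` excludes the normal.
    refine (h_split _ hr _ ![c - -(c' / s') * s, s + -(c' / s') * c, 0] c' (s' ^ 2) ?_ ?_).resolve_right
      fun hn => far c s (-(c' / s')) hcs ?_ hr hn
    · simp only [Matrix.vec3_dotProduct']; field_simp; ring
    · ext i; fin_cases i
      · simp; field_simp; linear_combination -c * hcs'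
      · simp; field_simp; linear_combination -s * hcs'
      · simp
    · rw [neg_sq, div_pow, le_div_iff₀ (by positivity)]; exact hT
  intro h
  have hcos : Real.cos (Real.pi / 10) ^ 2 = 1 / 2 + (1 + √5) / 4 / 2 := by
    rw [Real.cos_sq, ← Real.cos_pi_div_five]; congr 3; ring
  have hsin : 0 < Real.sin (Real.pi / 10) :=
    Real.sin_pos_of_pos_of_lt_pi (by positivity) (by linarith [Real.pi_pos])
  -- `near` needs `cos² (π / 10) = (5 + √5) / 8 ≥ 8 / 9`, that is `√5 ≥ 19 / 9`.
  have h5 : (2.2 : ℝ) ≤ √5 := Real.le_sqrt_of_sq_le (by norm_num)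
  have rot (n : ℕ) : ![Real.cos (n * (Real.pi / 10)), Real.sin (n * (Real.pi / 10)), 0] ∈ C := by
    induction n with
    | zero => simpa using h
    | succ n ih =>
      have := near _ _ (Real.cos (Real.pi / 10)) (Real.sin (Real.pi / 10))
        (Real.cos_sq_add_sin_sq _) (Real.cos_sq_add_sin_sq _) hsin.ne'
        (by rw [Real.sin_sq, hcos]; linarith) ih
      rwa [← Real.cos_add, ← Real.sin_add, ← add_one_mul, ← Nat.cast_succ] at this
  have h5 := rot 5
  rw [show ((5 : ℕ) : ℝ) * (Real.pi / 10) = Real.pi / 2 by push_cast; ring, Real.cos_pi_div_two,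
    Real.sin_pi_div_two] at h5
  exact h_orth _ h _ h5 (by simp)

end Rays

/-! ### Sasaki projections and verified propositions. -/

section Lattice

variable {L : Type*} [OrthomodularLattice L]

theorem OrthomodularLattice.compl_bot_eq : (⊥ : L)ᶜ = ⊤ := by
  simpa using sup_compl_eq_top (⊥ : L)

/-- By orthomodularity, any excess over `n` would lie below both `k ⊔ n` and its complement. -/
theorem OrthomodularLattice.inf_sup_eq_right_of_le_compl {k n : L} (h : n ≤ kᶜ) :
    kᶜ ⊓ (k ⊔ n) = n := by
  refine le_antisymm ?_ (le_inf h le_sup_right)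
  have hle : n ≤ kᶜ ⊓ (k ⊔ n) := le_inf h le_sup_right
  rw [orthomodular _ _ hle]
  refine sup_le le_rfl ?_
  have hcompl : kᶜ ⊓ nᶜ ≤ (k ⊔ n)ᶜ := by
    have : k ⊔ n ≤ (kᶜ ⊓ nᶜ)ᶜ := sup_le
      (by simpa only [compl_compl_eq] using compl_antitone _ _ (inf_le_left : kᶜ ⊓ nᶜ ≤ kᶜ))
      (by simpa only [compl_compl_eq] using compl_antitone _ _ (inf_le_right : kᶜ ⊓ nᶜ ≤ nᶜ))
    simpa only [compl_compl_eq] using compl_antitone _ _ this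
  have hbot : (kᶜ ⊓ (k ⊔ n)) ⊓ nᶜ ≤ (k ⊔ n) ⊓ (k ⊔ n)ᶜ :=
    le_inf (inf_le_left.trans inf_le_right)
      ((le_inf (inf_le_left.trans inf_le_left) inf_le_right).trans hcompl)
  rw [inf_compl_eq_bot] at hbot
  exact hbot.trans bot_le

theorem sasaki_compl_le {p k n : L} (hp : p ≤ k ⊔ n) (hn : n ≤ kᶜ) : sasaki p kᶜ ≤ n := by
  rw [sasaki, OrthomodularLattice.compl_compl_eq]
  calc kᶜ ⊓ (p ⊔ k) ≤ kᶜ ⊓ (k ⊔ n) := inf_le_inf_left _ (sup_le hp le_sup_left)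
    _ = n := OrthomodularLattice.inf_sup_eq_right_of_le_compl hn

theorem sasaki_eq_bot_of_le_compl {p q : L} (h : p ≤ qᶜ) : sasaki p q = ⊥ := by
  rw [sasaki, sup_eq_right.mpr h, OrthomodularLattice.inf_compl_eq_bot]

theorem isObservable_pair [DecidableEq L] {p : L} (hp : p ≠ ⊥) (hp' : pᶜ ≠ ⊥) :
    IsObservable {p, pᶜ} where
  ne_bot := by simp [hp, hp']
  orthogonal := by
    intro q hq r hr hqr
    simp only [Finset.mem_insert, Finset.mem_singleton] at hq hr
    rcases hq with rfl | rfl <;> rcases hr with rfl | rfl <;>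
      simp_all [OrthomodularLattice.compl_compl_eq]
  sup_eq_top := by simpa using OrthomodularLattice.sup_compl_eq_top p

namespace MeasurementGraph

variable {G : MeasurementGraph L} {a : G.A}

theorem IsModel.verifies_of_le_sup (hG : G.IsModel) {p k n : L} (hp : G.Verifies a p)
    (hk : G.Verifies a kᶜ) (hpkn : p ≤ k ⊔ n) (hn : n ≤ kᶜ) : G.Verifies a n :=
  hG.verifies_mono _ _ (sasaki_compl_le hpkn hn) _ (hG.verifies_sasaki _ _ _ hp hk)

theorem IsModel.not_le_compl (hG : G.IsModel) {p q : L} (hp : G.Verifies a p)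
    (hq : G.Verifies a q) : ¬ p ≤ qᶜ := fun h =>
  hG.not_verifies_bot a (sasaki_eq_bot_of_le_compl h ▸ hG.verifies_sasaki _ _ _ hp hq)

theorem IsModel.verifies_or_verifies_compl (hG : G.IsModel)
    (ha : ∀ O : Finset L, IsObservable O → ∃ p ∈ O, G.Verifies a p) (p : L) :
    G.Verifies a p ∨ G.Verifies a pᶜ := by
  classical
  by_cases hp : p = ⊥
  · right
    rw [hp, OrthomodularLattice.compl_bot_eq]
    exact hG.verifies_top a
  by_cases hp' : pᶜ = ⊥
  · left
    rw [← OrthomodularLattice.compl_compl_eq p, hp', OrthomodularLattice.compl_bot_eq]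
    exact hG.verifies_top a
  simpa using ha _ (isObservable_pair hp hp')

end MeasurementGraph

end Lattice

/-! ### Copies of `ℝ³` in the Hilbert lattice. -/

section Hilbert

variable {𝕜 H : Type*} [RCLike 𝕜] [NormedAddCommGroup H] [InnerProductSpace 𝕜 H]
variable {κ : Type*}

variable (𝕜) in
/-- The closed linear span of a family of vectors. -/
noncomputable def closedSpan (v : κ → H) : ClosedSubmodule 𝕜 H :=
  (Submodule.span 𝕜 (Set.range v)).closure

theorem closedSpan_le {v : κ → H} {p : ClosedSubmodule 𝕜 H} :
    closedSpan 𝕜 v ≤ p ↔ ∀ k, v k ∈ p := by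
  rw [closedSpan, Submodule.closure_le, Submodule.span_le, Set.range_subset_iff]
  rfl

theorem mem_closedSpan (v : κ → H) (k : κ) : v k ∈ closedSpan 𝕜 v := closedSpan_le.mp le_rfl k

theorem closedSpan_le_sup_of_eq_add {u v w : κ → H} (α β : 𝕜)
    (h : ∀ k, u k = α • v k + β • w k) : closedSpan 𝕜 u ≤ closedSpan 𝕜 v ⊔ closedSpan 𝕜 w := by
  refine closedSpan_le.mpr fun k => ?_
  rw [h k]
  exact add_mem
    (SMulMemClass.smul_mem α ((le_sup_left : _ ≤ closedSpan 𝕜 v ⊔ closedSpan 𝕜 w)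
      (mem_closedSpan v k)))
    (SMulMemClass.smul_mem β ((le_sup_right : _ ≤ closedSpan 𝕜 v ⊔ closedSpan 𝕜 w)
      (mem_closedSpan w k)))

variable (𝕜) in
/-- The closed subspace spanned by the real combinations, with coefficient vector `x`, of three
families of vectors. -/
noncomputable def ray (b : Fin 3 → κ → H) (x : Fin 3 → ℝ) : ClosedSubmodule 𝕜 H :=
  closedSpan 𝕜 fun k => ∑ j, (x j : 𝕜) • b j k

theorem ray_le_sup (b : Fin 3 → κ → H) {x y z : Fin 3 → ℝ} (α β : ℝ) (h : x = α • y + β • z) :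
    ray 𝕜 b x ≤ ray 𝕜 b y ⊔ ray 𝕜 b z := by
  refine closedSpan_le_sup_of_eq_add (α : 𝕜) (β : 𝕜) fun k => ?_
  simp [h, Finset.smul_sum, ← Finset.sum_add_distrib, add_smul, mul_smul]

variable [CompleteSpace H]

theorem closedSpan_le_compl {κ' : Type*} {v : κ → H} {w : κ' → H}
    (h : ∀ k l, inner 𝕜 (w l) (v k) = 0) : closedSpan 𝕜 v ≤ (closedSpan 𝕜 w)ᶜ := by
  refine closedSpan_le.mpr fun k u hu => ?_
  have hw : closedSpan 𝕜 w ≤ ⟨(Submodule.span 𝕜 {v k})ᗮ, Submodule.isClosed_orthogonal _⟩ :=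
    closedSpan_le.mpr fun l => Submodule.mem_orthogonal_singleton_iff_inner_left.mpr (h k l)
  exact Submodule.mem_orthogonal_singleton_iff_inner_left.mp (hw hu)

/-- Generators with different `k` are orthogonal; those with the same `k` have inner product `x ⬝ᵥ
y`. -/
theorem ray_le_compl {b : Fin 3 → κ → H} (hb : Orthonormal 𝕜 fun i : Fin 3 × κ => b i.1 i.2)
    {x y : Fin 3 → ℝ} (h : x ⬝ᵥ y = 0) : ray 𝕜 b x ≤ (ray 𝕜 b y)ᶜ := by
  classical
  refine closedSpan_le_compl fun k l => ?_
  have hb' (i j : Fin 3) : inner 𝕜 (b i l) (b j k) = if i = j ∧ l = k then 1 else 0 := by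
    simpa [Prod.ext_iff] using orthonormal_iff_ite.mp hb (i, l) (j, k)
  have h' : (x 0 : 𝕜) * y 0 + x 1 * y 1 + x 2 * y 2 = 0 := by
    rw [dotProduct, Fin.sum_univ_three] at h
    exact_mod_cast congrArg (RCLike.ofReal (K := 𝕜)) h
  by_cases hlk : l = k
  · subst hlk
    simp only [Fin.sum_univ_three, inner_add_left, inner_add_right, inner_smul_left,
      inner_smul_right, hb', RCLike.conj_ofReal]
    simpa [mul_comm] using h'
  · simp [sum_inner, inner_sum, inner_smul_left, inner_smul_right, hb', hlk]

theorem MeasurementGraph.IsModel.not_verifies_ray {G : MeasurementGraph (ClosedSubmodule 𝕜 H)}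
    (hG : G.IsModel) {a : G.A}
    (ha : ∀ O : Finset (ClosedSubmodule 𝕜 H), IsObservable O → ∃ p ∈ O, G.Verifies a p)
    {b : Fin 3 → κ → H} (hb : Orthonormal 𝕜 fun i : Fin 3 × κ => b i.1 i.2) :
    ¬ G.Verifies a (ray 𝕜 b ![1, 0, 0]) := by
  refine not_mem_of_projection_rules {x | G.Verifies a (ray 𝕜 b x)} ?_ ?_ ?_
  · exact fun x hx y hy h => hG.not_le_compl hx hy (ray_le_compl hb h)
  · intro p hp r hr k n hrk hnk hpkn
    refine hG.verifies_of_le_sup hp ?_ (ray_le_sup b 1 1 (by simpa using hpkn))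
      (ray_le_compl hb hnk)
    exact hG.verifies_mono _ _ (ray_le_compl hb hrk) _ hr
  · intro p hp q n α β hnq hpqn
    exact (hG.verifies_or_verifies_compl ha _).imp_right fun hq =>
      hG.verifies_of_le_sup hp hq (ray_le_sup b α β hpqn) (ray_le_compl hb hnq)

theorem isObservable_image_closedSpan [DecidableEq (ClosedSubmodule 𝕜 H)] [Nonempty κ] {n : ℕ}
    {b : κ × Fin n → H} (hb : Orthonormal 𝕜 b)
    (hspan : (Submodule.span 𝕜 (Set.range b)).topologicalClosure = ⊤) :
    IsObservable (Finset.univ.image fun i => closedSpan 𝕜 fun k => b (k, i)) where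
  ne_bot := by
    simp only [Finset.mem_image, Finset.mem_univ, true_and, forall_exists_index,
      forall_apply_eq_imp_iff]
    intro i hi
    obtain ⟨k⟩ := ‹Nonempty κ›
    have hk := mem_closedSpan (𝕜 := 𝕜) (fun k => b (k, i)) k
    rw [hi] at hk
    exact hb.ne_zero (k, i) hk
  orthogonal := by
    simp only [Finset.mem_image, Finset.mem_univ, true_and, forall_exists_index,
      forall_apply_eq_imp_iff]
    intro i j hij
    exact closedSpan_le_compl fun k l => hb.inner_eq_zero fun h => hij (by simp_all)
  sup_eq_top := by
    rw [eq_top_iff]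
    have htop : (⊤ : ClosedSubmodule 𝕜 H) ≤ closedSpan 𝕜 b := fun x _ =>
      (hspan ▸ Submodule.mem_top : x ∈ (Submodule.span 𝕜 (Set.range b)).topologicalClosure)
    refine htop.trans (closedSpan_le.mpr fun ⟨k, i⟩ => ?_)
    have hle := Finset.le_sup (f := id) (Finset.mem_image_of_mem
      (fun i => closedSpan 𝕜 fun k => b (k, i)) (Finset.mem_univ i))
    exact (show closedSpan 𝕜 (fun k => b (k, i)) ≤ _ from hle) (mem_closedSpan _ k)

/-- A Hilbert space of dimension at least `3` has a Hilbert basis that splits into `n ≥ 3` families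
of equal size. -/
theorem exists_orthonormal_prod_fin {H : Type v} [NormedAddCommGroup H] [InnerProductSpace 𝕜 H]
    [CompleteSpace H] (hdim : 3 ≤ Module.rank 𝕜 H) :
    ∃ (κ : Type v) (n : ℕ) (b : κ × Fin n → H), Nonempty κ ∧ 3 ≤ n ∧ Orthonormal 𝕜 b ∧
      (Submodule.span 𝕜 (Set.range b)).topologicalClosure = ⊤ := by
  obtain ⟨w, b, -⟩ := exists_hilbertBasis 𝕜 H
  suffices h : ∃ (κ : Type v) (n : ℕ), Nonempty κ ∧ 3 ≤ n ∧ Nonempty (κ × Fin n ≃ w) by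
    obtain ⟨κ, n, hκ, hn, ⟨e⟩⟩ := h
    refine ⟨κ, n, b ∘ e, hκ, hn, b.orthonormal.comp _ e.injective, ?_⟩
    rw [e.surjective.range_comp]
    exact b.dense_span
  cases finite_or_infinite w with
  | inl hw =>
    have := Fintype.ofFinite w
    refine ⟨PUnit, Fintype.card w, inferInstance, ?_,
      ⟨(Equiv.punitProd _).trans (Fintype.equivFin w).symm⟩⟩
    rw [rank_eq_card_basis b.toOrthonormalBasis.toBasis] at hdim
    exact_mod_cast hdim
  | inr hw =>
    -- An infinite basis index set is equipotent with three copies of itself.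
    refine ⟨w, 3, inferInstance, le_rfl, Cardinal.eq.mp ?_⟩
    rw [Cardinal.mk_prod]
    simpa using Cardinal.mul_eq_left (Cardinal.aleph0_le_mk w)
      ((Cardinal.natCast_lt_aleph0 (n := 3)).le.trans (Cardinal.aleph0_le_mk w)) (by norm_num)

theorem exists_injective_fin_three {n : ℕ} (hn : 3 ≤ n) (i : Fin n) :
    ∃ e : Fin 3 → Fin n, Function.Injective e ∧ e 0 = i := by
  refine ⟨Equiv.swap (Fin.castLE hn 0) i ∘ Fin.castLE hn,
    (Equiv.injective _).comp (Fin.castLE_injective hn), by simp⟩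

end Hilbert

theorem mainTheorem4 {𝕜 : Type u} {H : Type v} [RCLike 𝕜] [NormedAddCommGroup H]
    [InnerProductSpace 𝕜 H] [CompleteSpace H] (hdim : 3 ≤ Module.rank 𝕜 H) :
    ¬ ∃ G : MeasurementGraph.{v, w} (ClosedSubmodule 𝕜 H), G.IsModel ∧
      ∃ a : G.A, ∀ O : Finset (ClosedSubmodule 𝕜 H), IsObservable O →
        ∃ p ∈ O, G.Verifies a p := by
  classical
  rintro ⟨G, hG, a, ha⟩
  obtain ⟨κ, n, b, hκ, hn, hb, hspan⟩ := exists_orthonormal_prod_fin hdim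
  obtain ⟨p, hp, hap⟩ := ha _ (isObservable_image_closedSpan hb hspan)
  obtain ⟨i, -, rfl⟩ := Finset.mem_image.mp hp
  -- The verified family takes the role of `e₁`, joined by two others.
  obtain ⟨e, he, rfl⟩ := exists_injective_fin_three hn i
  refine hG.not_verifies_ray ha (b := fun j k => b (k, e j)) ?_ ?_
  · refine hb.comp (fun j : Fin 3 × κ => (j.2, e j.1)) fun j j' h => ?_
    exact Prod.ext (he (congrArg Prod.snd h)) (congrArg Prod.fst h)
  · simpa [ray, Fin.sum_univ_three] using hap
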